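/- Let $K$ be a field. For a finite group $G$, let $G$ act on the rational function field $K(x(g):g\in G)$ by $K$-automorphisms via $h\cdot x(g)=x(hg)$ for $g,h\in G$, and let $K(G)=K(x(g):g\in G)^G$ denote the fixed field. A field extension $L/F$ is called rational if it is purely transcendental, i.e. $L=F(S)$ for some (possibly empty) set $S\subseteq L$ that is algebraically independent over $F$. Theorem 1.7. Suppose that $\operatorname{char}K=p>0$ and let $\widetilde G=H\times G$ be a direct product of finite groups, where $H$ is a $p$-group. Then there is a $K$-embedding (an injective $K$-linear homomorphism of fields) $\varphi\colon K(G)\to K(\widetilde G)$ such that $K(\widetilde G)$ is rational over $\varphi(K(G))$. In particular (Kuniyoshi's theorem), $K(H)$ is rational over $K$ for every finite $p$-group $H$. -/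

import Mathlib

/-- The rational function field `K(x(g) : g ∈ G)` in variables indexed by `G`. -/
abbrev RegularField (K G : Type*) [Field K] : Type _ :=
  FractionRing (MvPolynomial G K)

/-- The variable `x(g)` of `K(x(g) : g ∈ G)`. -/
noncomputable def RegularField.x (K : Type*) {G : Type*} [Field K] (g : G) : RegularField K G :=
  algebraMap (MvPolynomial G K) (RegularField K G) (MvPolynomial.X g)

/-- The action of `G` on the polynomial ring `K[x(g) : g ∈ G]` by `K`-automorphisms,
`h · x(g) = x(hg)`. -/
noncomputable def regularPolyAction (K G : Type*) [Field K] [Group G] :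
    G →* (MvPolynomial G K ≃ₐ[K] MvPolynomial G K) where
  toFun h := MvPolynomial.renameEquiv K (Equiv.mulLeft h)
  map_one' := by
    ext p
    simp
  map_mul' a b := by
    apply AlgEquiv.ext
    intro p
    simp [MvPolynomial.rename_rename, Function.comp_def]

/-- The action of `G` on `K(x(g) : g ∈ G)` by `K`-automorphisms, `h · x(g) = x(hg)`. -/
noncomputable def regularAction (K G : Type*) [Field K] [Group G] :
    G →* (RegularField K G ≃ₐ[K] RegularField K G) :=
  (IsFractionRing.fieldEquivOfAlgEquivHom K (RegularField K G)).comp (regularPolyAction K G)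

theorem regularAction_x (K : Type*) {G : Type*} [Field K] [Group G] (h g : G) :
    regularAction K G h (RegularField.x K g) = RegularField.x K (h * g) := by
  simp [regularAction, regularPolyAction, RegularField.x]

/-- The fixed field `K(G) = K(x(g) : g ∈ G)^G`. -/
noncomputable def noetherField (K G : Type*) [Field K] [Group G] :
    IntermediateField K (RegularField K G) :=
  IntermediateField.fixedField (regularAction K G).range

theorem mem_noetherField_iff {K G : Type*} [Field K] [Group G] (f : RegularField K G) :
    f ∈ noetherField K G ↔ ∀ h : G, regularAction K G h f = f := by
  simp [noetherField]

/-- The field `L` is rational (that is, purely transcendental) over `F`: it is generated as a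
field over `F` by a set of elements that are algebraically independent over `F`. -/
def IsRationalOver (F L : Type*) [Field F] [Field L] [Algebra F L] : Prop :=
  ∃ s : Set L, AlgebraicIndependent F ((↑) : s → L) ∧ IntermediateField.adjoin F s = ⊤

/-! In characteristic `p` every nonzero representation of the `p`-group H has a nonzero fixed
vector, so K[H] has a basis b_0, b_1, … on which H acts unitriangularly. For each g in G the
variables x(h, g) span a copy of K[H]; let Y_g(b_i) be the corresponding linear forms. The forms
θ(g) = Y_g(b_0) are fixed by H and permuted by G like the variables x(g), so K(θ) is a copy of
K(x(g) : g ∈ G), and its fixed field is φ(K(G)).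

The other forms are still permuted by G. They are replaced by the moments Z_k(b_i) = Σ_g Y_g(b_i)
θ(g)^k for k < |G|, which G fixes and H translates by combinations of the Z_k(b_j) with j < i. The
θ(g) are distinct, so the moments determine the Y_g(b_i) (Vandermonde). Hence the whole field arises
from K(θ) by adjoining independent variables, each translated by elements of the field before it.
One such variable over M turns the fixed field of M into a simple transcendental extension of it
(`exists_fixed_generator_of_translation`); iteration is
`exists_algebraicIndependent_fixed_of_triangular`. Kuniyoshi's theorem is the same iteration started
from K, with the linear forms themselves as variables. -/

/-! ### Unitriangular bases for `p`-groups in characteristic `p` -/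

/-- A nonzero representation of a finite `p`-group in characteristic `p` has a nonzero
fixed vector. -/
theorem IsPGroup.exists_ne_zero_fixed {p : ℕ} [Fact p.Prime] {K : Type*} [Field K] [CharP K p]
    {H : Type*} [Group H] [Finite H] (hH : IsPGroup p H) {V : Type*} [AddCommGroup V] [Module K V]
    [Nontrivial V] (ρ : Representation K H V) : ∃ v : V, v ≠ 0 ∧ ∀ h, ρ h v = v := by
  have hp (v : V) : p • v = 0 := by
    rw [← Nat.cast_smul_eq_nsmul K, CharP.cast_eq_zero, zero_smul]
  obtain ⟨_⟩ : Nonempty (Module (ZMod p) V) := ⟨AddCommGroup.zmodModule hp⟩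
  obtain ⟨v, hv⟩ := exists_ne (0 : V)
  -- K may be infinite; the span over the prime field of a single orbit is finite and stable, so
  -- orbits can be counted there.
  let S : Submodule (ZMod p) V := Submodule.span (ZMod p) (Set.range fun h : H => ρ h v)
  have hS (h : H) : ∀ s ∈ S, ρ h s ∈ S := by
    have : S ≤ S.comap ((ρ h).toAddMonoidHom.toZModLinearMap p) := by
      rw [Submodule.span_le]
      rintro _ ⟨g, rfl⟩
      exact Submodule.subset_span ⟨h * g, by simp⟩
    exact this
  have hvS : v ∈ S := Submodule.subset_span ⟨1, by simp⟩
  have : Module.Finite (ZMod p) S := FiniteDimensional.span_of_finite _ (Set.finite_range _)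
  have : Finite S := Module.finite_of_finite (ZMod p)
  let _ : MulAction H S :=
    { smul := fun h s => ⟨ρ h s, hS h s s.2⟩
      one_smul := fun s => Subtype.ext (by change ρ 1 s = s; simp)
      mul_smul := fun a b s => Subtype.ext (by change ρ (a * b) s = ρ a (ρ b s); simp) }
  have hdvd : p ∣ Nat.card S := by
    have : addOrderOf (⟨v, hvS⟩ : S) = p :=
      addOrderOf_eq_prime (Subtype.ext (hp v)) fun h => hv (congrArg Subtype.val h)
    exact (dvd_of_eq this.symm).trans (addOrderOf_dvd_natCard _)
  -- The number of fixed points is congruent to |S| modulo `p`, hence divisible by `p`; as 0 is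
  -- fixed, there is another one.
  obtain ⟨b, hb, hb0⟩ := hH.exists_fixed_point_of_prime_dvd_card_of_fixed_point S hdvd
    (a := 0) fun h => Subtype.ext (map_zero (ρ h))
  exact ⟨b, fun h => hb0 (Subtype.ext h.symm), fun h => congrArg Subtype.val (hb h)⟩

/-- A finite-dimensional representation of a finite `p`-group in characteristic `p` has
linearly independent unitriangular families of every length up to the dimension. -/
theorem IsPGroup.exists_unitriangular {p : ℕ} [Fact p.Prime] {K : Type*} [Field K] [CharP K p]
    {H : Type*} [Group H] [Finite H] (hH : IsPGroup p H) {V : Type*} [AddCommGroup V] [Module K V]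
    [FiniteDimensional K V] (ρ : Representation K H V) (n : ℕ) (hn : n ≤ Module.finrank K V) :
    ∃ b : Fin n → V, LinearIndependent K b ∧
      ∀ h i, ρ h (b i) - b i ∈ Submodule.span K (b '' Set.Iio i) := by
  induction n with
  | zero => exact ⟨Fin.elim0, linearIndependent_empty_type, fun _ i => i.elim0⟩
  | succ n ih =>
    obtain ⟨b, hb, hρ⟩ := ih (by omega)
    set U := Submodule.span K (Set.range b) with hU
    have hmem (i) : b i ∈ U := Submodule.subset_span ⟨i, rfl⟩
    have hstab (h : H) : U ≤ U.comap (ρ h) := by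
      rw [hU, Submodule.span_le]
      rintro _ ⟨i, rfl⟩
      have := U.add_mem (Submodule.span_mono (Set.image_subset_range _ _) (hρ h i)) (hmem i)
      simpa using this
    have hne : U ≠ ⊤ := fun h => by
      have := finrank_span_eq_card hb
      rw [← hU, h, finrank_top, Fintype.card_fin] at this
      omega
    -- The next vector lifts a nonzero fixed vector of V/U: it lies outside U and is moved by
    -- elements of U.
    have : Nontrivial (V ⧸ U) := Submodule.Quotient.nontrivial_iff.2 hne
    obtain ⟨w, hw0, hw⟩ := hH.exists_ne_zero_fixed (ρ.quotient U hstab)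
    obtain ⟨w, rfl⟩ := U.mkQ_surjective w
    have hwU : w ∉ U := fun h => hw0 (by simpa using h)
    refine ⟨Fin.snoc b w, hb.finSnoc hwU, fun h i => ?_⟩
    have hlast (h : H) : ρ h w - w ∈ U := by
      rw [← Submodule.Quotient.eq]
      exact hw h
    induction i using Fin.lastCases with
    | last =>
      rw [Fin.snoc_last]
      refine Submodule.span_mono ?_ (hlast h)
      rintro _ ⟨i, rfl⟩
      exact ⟨i.castSucc, Fin.castSucc_lt_last i, by simp⟩
    | cast i =>
      rw [Fin.snoc_castSucc]
      refine Submodule.span_mono ?_ (hρ h i)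
      rintro _ ⟨j, hj, rfl⟩
      exact ⟨j.castSucc, Fin.castSucc_lt_castSucc_iff.2 hj, by simp⟩

/-! ### Fixed fields under triangular translations -/

open Polynomial in
/-- If a finite group acts on a field `E`, stabilizes a subfield `M`, and moves an element `x`,
transcendental over `M`, by elements of `M`, then the fixed field of `M(x)` is generated over
the fixed field of `M` by one element, which is transcendental over `M`. -/
theorem exists_fixed_generator_of_translation {K E Γ : Type*} [Field K] [Field E] [Algebra K E]
    [Group Γ] [Finite Γ] (act : Γ →* (E ≃ₐ[K] E)) (M : IntermediateField K E)
    (hM : ∀ γ, ∀ m ∈ M, act γ m ∈ M) {x : E} (hx : Transcendental M x)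
    (hγx : ∀ γ, act γ x - x ∈ M) :
    ∃ f ∈ IntermediateField.adjoin M {x}, (∀ γ, act γ f = f) ∧ Transcendental M f ∧
      ∀ N : Subfield E, (∀ m ∈ M, (∀ γ, act γ m = m) → m ∈ N) → f ∈ N →
        ∀ u ∈ IntermediateField.adjoin M {x}, (∀ γ, act γ u = u) → u ∈ N := by
  classical
  have := Fintype.ofFinite Γ
  have hinj : Function.Injective (aeval (R := M) x) := transcendental_iff_injective.1 hx
  let σ (γ : Γ) : M →+* M :=
    ((act γ : E →+* E).comp (algebraMap M E)).codRestrict M fun m => hM γ m m.2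
  have hσ (γ : Γ) (m : M) : (σ γ m : E) = act γ m := rfl
  -- Lift of the action to polynomials: γ acts on coefficients and sends X to X + (γx − x). It
  -- preserves degrees.
  let T (γ : Γ) : M[X] →+* M[X] :=
    (compRingHom (X + C ⟨_, hγx γ⟩)).comp (mapRingHom (σ γ))
  have hT (γ : Γ) (P : M[X]) : aeval x (T γ P) = act γ (aeval x P) := by
    have : (aeval (R := M) x : M[X] →+* E).comp (T γ) =
        (act γ : E →+* E).comp (aeval (R := M) x : M[X] →+* E) := by
      ext m
      · simp [T, IntermediateField.algebraMap_apply, hσ]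
      · simp [T, IntermediateField.algebraMap_apply]
    exact congrArg (fun φ : M[X] →+* E => φ P) this
  have hdeg (γ : Γ) (P : M[X]) : (T γ P).natDegree = P.natDegree := by
    simp [T, natDegree_comp, natDegree_map]
  let Inv (P : M[X]) : Prop := ∀ γ, T γ P = P
  have hInv (P : M[X]) : Inv P ↔ ∀ γ, act γ (aeval x P) = aeval x P :=
    forall_congr' fun γ => by rw [← hT, hinj.eq_iff]
  have hprod (a : E) (γ : Γ) : act γ (∏ δ, act δ a) = ∏ δ, act δ a := by
    rw [map_prod]
    exact Fintype.prod_equiv (Equiv.mulLeft γ) _ _ fun δ => by simp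
  -- The product of the translates of X is invariant of degree |Γ|, so an invariant Q of least
  -- positive degree exists; the generator is Q(x).
  have hex : ∃ n, ∃ Q : M[X], Inv Q ∧ 0 < Q.natDegree ∧ Q.natDegree = n := by
    refine ⟨_, ∏ γ, T γ X, (hInv _).2 fun γ => ?_, ?_, rfl⟩
    · simp only [map_prod, hT, aeval_X]
      simpa only [map_prod] using hprod x γ
    · rw [natDegree_prod _ _ fun γ _ h => ?_]
      · simp [hdeg, Fintype.card_pos]
      · have := hdeg γ X
        simp [h] at this
  obtain ⟨Q, hQ, hQpos, hQmin⟩ := Nat.find_spec hex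
  have hmin (P : M[X]) (hP : Inv P) (h : P.natDegree < Q.natDegree) : P.natDegree = 0 := by
    by_contra h0
    exact Nat.find_min hex (hQmin ▸ h) ⟨P, hP, Nat.pos_of_ne_zero h0, rfl⟩
  have hQ0 : Q ≠ 0 := fun h => by simp [h] at hQpos
  refine ⟨aeval x Q, IntermediateField.algebra_adjoin_le_adjoin _ _
    (by rw [Algebra.adjoin_singleton_eq_range_aeval]; exact ⟨Q, rfl⟩), (hInv Q).1 hQ, ?_, ?_⟩
  · exact hx.aeval Q hQpos.ne' (mem_nonZeroDivisors_of_ne_zero (leadingCoeff_ne_zero.2 hQ0))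
  intro N hMN hfN
  have hpoly (n : ℕ) : ∀ P : M[X], Inv P → P.natDegree = n → aeval x P ∈ N := by
    induction n using Nat.strong_induction_on with
    | _ n ih =>
      intro P hP hPn
      have hconst (R : M[X]) (hR : Inv R) (h : R.natDegree = 0) : aeval x R ∈ N := by
        have hR' := (hInv R).1 hR
        rw [eq_C_of_natDegree_eq_zero h, aeval_C] at hR' ⊢
        exact hMN _ (R.coeff 0).2 hR'
      have hlt : (P % Q).natDegree < Q.natDegree := natDegree_mod_lt P hQpos.ne'
      -- Uniqueness of division: were the quotient to change, Q times the difference would have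
      -- degree at least deg Q, yet it is a difference of remainders.
      have hdiv : Inv (P / Q) := fun γ => by
        have h1 : Q * (P / Q) + P % Q = P := EuclideanDomain.div_add_mod P Q
        have h2 := congrArg (T γ) h1
        rw [hP γ, map_add, map_mul, hQ γ] at h2
        have h3 : Q * (T γ (P / Q) - P / Q) = P % Q - T γ (P % Q) := by
          linear_combination h2 - h1
        by_contra hne
        have h4 := congrArg natDegree h3
        rw [natDegree_mul hQ0 (sub_ne_zero.2 hne)] at h4
        have := natDegree_sub_le (P % Q) (T γ (P % Q))
        rw [hdeg, max_self] at this
        omega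
      have hmod : Inv (P % Q) := fun γ => by
        have h1 : P % Q = P - Q * (P / Q) := EuclideanDomain.mod_eq_sub_mul_div P Q
        rw [h1, map_sub, map_mul, hP γ, hQ γ, hdiv γ]
      rw [← EuclideanDomain.div_add_mod P Q, map_add, map_mul]
      refine N.add_mem (N.mul_mem hfN ?_) (hconst _ hmod (hmin _ hmod hlt))
      by_cases h0 : P.natDegree = 0
      · exact hconst _ hdiv (Nat.le_zero.1 (h0 ▸ natDegree_le_natDegree (degree_div_le P Q)))
      · have hP0 : P ≠ 0 := fun h => h0 (by rw [h, natDegree_zero])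
        by_cases hd : P / Q = 0
        · rw [hd, map_zero]
          exact N.zero_mem
        · exact ih _ (hPn ▸ natDegree_lt_natDegree hd
            (degree_div_lt hP0 (natDegree_pos_iff_degree_pos.1 hQpos))) _ hdiv rfl
  intro u hu hfix
  obtain ⟨a, b, rfl⟩ := (IntermediateField.mem_adjoin_simple_iff M u).1 hu
  by_cases hb : aeval x b = 0
  · simp [hb]
  -- Multiplying through by the other conjugates of the denominator makes it invariant; the
  -- numerator is then invariant too.
  set b' := ∏ γ, T γ b with hb'
  set c := ∏ γ ∈ Finset.univ.erase 1, T γ b with hc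
  have hbc : b' = b * c := by
    rw [hb', hc, ← Finset.mul_prod_erase _ _ (Finset.mem_univ (1 : Γ))]
    congr 1
    exact hinj (by simp [hT])
  have hb'inv : ∀ γ, act γ (aeval x b') = aeval x b' := fun γ => by
    simp only [hb', map_prod, hT]
    simpa only [map_prod] using hprod (aeval x b) γ
  have hb'0 : aeval x b' ≠ 0 := by
    simp only [hb', map_prod, hT]
    exact Finset.prod_ne_zero_iff.2 fun γ _ => by simpa using hb
  have hu' : aeval x a / aeval x b = aeval x (a * c) / aeval x b' := by
    rw [div_eq_div_iff hb hb'0, hbc]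
    simp only [map_mul]
    ring
  have hac : aeval x (a * c) = aeval x a / aeval x b * aeval x b' := by
    rw [hu', div_mul_cancel₀ _ hb'0]
  rw [hu']
  exact N.div_mem (hpoly _ _ ((hInv _).2 fun γ => by rw [hac, map_mul, hfix, hb'inv]) rfl)
    (hpoly _ _ ((hInv _).2 hb'inv) rfl)

open IntermediateField.algebraAdjoinAdjoin in
theorem AlgebraicIndependent.transcendental_intermediateField_adjoin {ι K E : Type*} [Field K]
    [Field E] [Algebra K E] {w : ι → E} (hw : AlgebraicIndependent K w) {s : Set ι} {i : ι}
    (hi : i ∉ s) : Transcendental (IntermediateField.adjoin K (w '' s)) (w i) := fun h =>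
  hw.transcendental_adjoin hi ((IsFractionRing.isAlgebraic_iff (Algebra.adjoin K (w '' s))
    (IntermediateField.adjoin K (w '' s)) E).2 h)

/-- Let a finite group act on a field `E` generated over `K` by an algebraically independent
finite family `w`, stabilizing the field `L` generated by a part `s₀` of the family and acting on
the other members by translations that are triangular with respect to a rank function `r`. Then
the fixed field of `E` is rational over the fixed field of `L`, the latter being given as the
image of a field `k`. -/
theorem exists_algebraicIndependent_fixed_of_triangular {K E Γ ι k : Type*} [Field K] [Field E]
    [Algebra K E] [Group Γ] [Finite Γ] [Finite ι] [Field k] [Algebra k E]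
    (act : Γ →* (E ≃ₐ[K] E)) {w : ι → E} (hw : AlgebraicIndependent K w) (r : ι → ℕ) (s₀ : Set ι)
    (hs₀ : ∀ γ, ∀ i ∈ s₀, act γ (w i) ∈ IntermediateField.adjoin K (w '' s₀))
    (hr : ∀ γ, ∀ i ∉ s₀,
      act γ (w i) - w i ∈ IntermediateField.adjoin K (w '' (s₀ ∪ {j | r j < r i})))
    (hk : ∀ x : E, x ∈ Set.range (algebraMap k E) ↔
      x ∈ IntermediateField.adjoin K (w '' s₀) ∧ ∀ γ, act γ x = x) :
    ∃ T : Set E, AlgebraicIndependent k ((↑) : T → E) ∧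
      ∀ x, x ∈ IntermediateField.adjoin k T ↔
        x ∈ IntermediateField.adjoin K (Set.range w) ∧ ∀ γ, act γ x = x := by
  classical
  have := Fintype.ofFinite ι
  -- Members are adjoined in order of increasing rank, so everything of smaller rank than the new
  -- one is already in s₀ ∪ s.
  suffices H : ∀ s : Finset ι, (∀ i ∈ s, ∀ j, r j < r i → j ∈ s₀ ∪ s) →
      ∃ T : Set E, AlgebraicIndependent k ((↑) : T → E) ∧
        ∀ x, x ∈ IntermediateField.adjoin k T ↔
          x ∈ IntermediateField.adjoin K (w '' (s₀ ∪ s)) ∧ ∀ γ, act γ x = x by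
    simpa using H Finset.univ (by simp)
  intro s
  induction s using Finset.induction_on_max_value r with
  | empty =>
    refine fun _ => ⟨∅, algebraicIndependent_empty_type_iff.2 (algebraMap k E).injective,
      fun x => ?_⟩
    rw [IntermediateField.adjoin_empty, IntermediateField.mem_bot, hk]
    simp
  | insert a s ha hmax ih =>
    intro hlow
    have hlow' : ∀ i ∈ s, ∀ j, r j < r i → j ∈ s₀ ∪ s := fun i hi j hj => by
      rcases hlow i (Finset.mem_insert_of_mem hi) j hj with h | h
      · exact Or.inl h
      · rcases Finset.mem_insert.1 h with rfl | h
        · exact absurd hj (hmax i hi).not_gt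
        · exact Or.inr h
    obtain ⟨T, hT, hTfix⟩ := ih hlow'
    by_cases ha₀ : a ∈ s₀
    · refine ⟨T, hT, fun x => ?_⟩
      rw [hTfix, Finset.coe_insert, Set.union_insert,
        Set.insert_eq_of_mem (Set.mem_union_left _ ha₀)]
    have hmono {S S' : Set ι} (h : S ⊆ S') : IntermediateField.adjoin K (w '' S) ≤
        IntermediateField.adjoin K (w '' S') :=
      IntermediateField.adjoin.mono _ _ _ (Set.image_mono h)
    set M := IntermediateField.adjoin K (w '' (s₀ ∪ s)) with hM
    have hMstab (γ : Γ) : ∀ m ∈ M, act γ m ∈ M := by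
      have : M ≤ M.comap (act γ : E →ₐ[K] E) := by
        rw [hM, IntermediateField.adjoin_le_iff]
        rintro _ ⟨i, hi, rfl⟩
        change act γ (w i) ∈ M
        by_cases hi₀ : i ∈ s₀
        · exact hmono Set.subset_union_left (hs₀ γ i hi₀)
        · have h1 : act γ (w i) - w i ∈ M := hmono (Set.union_subset Set.subset_union_left
            fun j hj => hlow' i (hi.resolve_left hi₀) j hj) (hr γ i hi₀)
          have h2 : w i ∈ M := IntermediateField.subset_adjoin K _ ⟨i, hi, rfl⟩
          simpa using M.add_mem h1 h2
      exact this
    have hγa (γ : Γ) : act γ (w a) - w a ∈ M := by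
      refine hmono (Set.union_subset Set.subset_union_left fun j hj => ?_) (hr γ a ha₀)
      rcases hlow a (Finset.mem_insert_self a s) j hj with h | h
      · exact Or.inl h
      · rcases Finset.mem_insert.1 h with rfl | h
        · exact absurd hj (lt_irrefl (r j))
        · exact Or.inr h
    obtain ⟨f, hfM, hffix, hftr, hfgen⟩ := exists_fixed_generator_of_translation act M hMstab
      (hw.transcendental_intermediateField_adjoin fun h => h.elim ha₀ ha) hγa
    have hM' (x : E) : x ∈ IntermediateField.adjoin M {w a} ↔
        x ∈ IntermediateField.adjoin K (w '' (s₀ ∪ ↑(insert a s))) := by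
      have := IntermediateField.adjoin_adjoin_left K (w '' (s₀ ∪ s)) {w a}
      rw [← IntermediateField.mem_restrictScalars K, this, Finset.coe_insert, Set.union_insert,
        Set.image_insert_eq, Set.union_singleton]
    have hTM (x : E) (hx : x ∈ Algebra.adjoin k T) : x ∈ M :=
      ((hTfix x).1 (IntermediateField.algebra_adjoin_le_adjoin k T hx)).1
    refine ⟨insert f T, AlgebraicIndepOn.insert (x := id) hT ?_, fun x => ⟨?_, ?_⟩⟩
    · rw [Set.image_id]
      -- f is transcendental over M, hence over the subring k[T] of M.
      let ψ : Algebra.adjoin k T →+* M :=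
        (algebraMap (Algebra.adjoin k T) E).codRestrict M fun x => hTM x x.2
      let _ : Algebra (Algebra.adjoin k T) M := ψ.toAlgebra
      have : IsScalarTower (Algebra.adjoin k T) M E := .of_algebraMap_eq fun _ => rfl
      exact hftr.restrictScalars (RingHom.injective_codRestrict.2 Subtype.val_injective)
    · have hle := hmono (Set.union_subset_union_right s₀
        (Finset.coe_subset.2 (Finset.subset_insert a s)))
      intro hx
      induction hx using IntermediateField.adjoin_induction with
      | mem y hy =>
        rcases hy with rfl | hy
        · exact ⟨(hM' y).1 hfM, hffix⟩
        · have := (hTfix y).1 (IntermediateField.subset_adjoin k T hy)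
          exact ⟨hle this.1, this.2⟩
      | algebraMap c =>
        have := (hTfix _).1 ((IntermediateField.adjoin k T).algebraMap_mem c)
        exact ⟨hle this.1, this.2⟩
      | add y z _ _ hy hz => exact ⟨add_mem hy.1 hz.1, fun γ => by rw [map_add, hy.2, hz.2]⟩
      | inv y _ hy => exact ⟨inv_mem hy.1, fun γ => by rw [map_inv₀, hy.2]⟩
      | mul y z _ _ hy hz => exact ⟨mul_mem hy.1 hz.1, fun γ => by rw [map_mul, hy.2, hz.2]⟩
    · rintro ⟨hx, hfix⟩
      refine hfgen (IntermediateField.adjoin k (insert f T)).toSubfield (fun m hm hmfix => ?_)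
        (IntermediateField.subset_adjoin k _ (Set.mem_insert f T)) x ((hM' x).2 hx) hfix
      exact IntermediateField.adjoin.mono k _ _ (Set.subset_insert f T) ((hTfix m).2 ⟨hm, hmfix⟩)

/-! ### Generators and embeddings of the rational function field -/

namespace RegularField

theorem algebraicIndependent_x (K J : Type*) [Field K] :
    AlgebraicIndependent K (x K : J → RegularField K J) :=
  (MvPolynomial.algebraicIndependent_X J K).map'
    (f := IsScalarTower.toAlgHom K (MvPolynomial J K) (RegularField K J))
    (IsFractionRing.injective _ _)

theorem algHom_ext {K J A : Type*} [Field K] [Field A] [Algebra K A]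
    {f g : RegularField K J →ₐ[K] A} (h : ∀ j, f (x K j) = g (x K j)) : f = g := by
  have : (f : RegularField K J →+* A) = g := by
    refine IsLocalization.ringHom_ext (nonZeroDivisors (MvPolynomial J K)) ?_
    have : f.comp (IsScalarTower.toAlgHom K (MvPolynomial J K) (RegularField K J)) =
        g.comp (IsScalarTower.toAlgHom K (MvPolynomial J K) (RegularField K J)) :=
      MvPolynomial.algHom_ext h
    exact congrArg (fun φ : MvPolynomial J K →ₐ[K] A => (φ : MvPolynomial J K →+* A)) this
  exact AlgHom.coe_ringHom_injective this

theorem adjoin_range_x (K J : Type*) [Field K] :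
    IntermediateField.adjoin K (Set.range (x K : J → RegularField K J)) = ⊤ := by
  refine eq_top_iff.2 fun u _ => ?_
  have hpoly (P : MvPolynomial J K) : algebraMap _ (RegularField K J) P ∈
      IntermediateField.adjoin K (Set.range (x K : J → RegularField K J)) := by
    have : algebraMap _ (RegularField K J) P = MvPolynomial.aeval (x K) P := by
      refine congrArg (fun φ : MvPolynomial J K →ₐ[K] RegularField K J => φ P)
        (?_ : IsScalarTower.toAlgHom K (MvPolynomial J K) (RegularField K J) = _)
      exact MvPolynomial.algHom_ext fun j => by simp [x]
    rw [this]
    refine IntermediateField.algebra_adjoin_le_adjoin _ _ ?_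
    rw [Algebra.adjoin_range_eq_range_aeval]
    exact ⟨P, rfl⟩
  obtain ⟨a, b, -, rfl⟩ := IsFractionRing.div_surjective (A := MvPolynomial J K) u
  exact div_mem (hpoly a) (hpoly b)

open IntermediateField.algebraAdjoinAdjoin in
/-- A generating family of `K(x(j) : j ∈ J)` indexed by as many elements as `J` has is
algebraically independent. -/
theorem algebraicIndependent_of_adjoin_eq_top {K J ι : Type*} [Field K] [Finite ι] (e : ι ≃ J)
    {w : ι → RegularField K J} (hw : IntermediateField.adjoin K (Set.range w) = ⊤) :
    AlgebraicIndependent K w := by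
  have : Algebra.IsAlgebraic (Algebra.adjoin K (Set.range w)) (RegularField K J) := by
    refine ⟨fun u => (IsFractionRing.isAlgebraic_iff _
      (IntermediateField.adjoin K (Set.range w)) _).2 ?_⟩
    exact isAlgebraic_algebraMap (⟨u, hw ▸ IntermediateField.mem_top⟩ :
      IntermediateField.adjoin K (Set.range w))
  -- The variables bound the transcendence degree below by |ι|, so a generating family of that size
  -- has no room for a relation.
  have hle := (((algebraicIndependent_x K J).comp e e.injective)).lift_cardinalMk_le_trdeg
  exact (Algebra.IsAlgebraic.isTranscendenceBasis_of_lift_le_trdeg_of_finite K w hle).1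

/-- The embedding of `K(x(j) : j ∈ J)` given by an algebraically independent family. -/
noncomputable def lift {K J A : Type*} [Field K] [Field A] [Algebra K A] {θ : J → A}
    (hθ : AlgebraicIndependent K θ) : RegularField K J →ₐ[K] A :=
  IsFractionRing.liftAlgHom (g := MvPolynomial.aeval θ)
    (algebraicIndependent_iff_injective_aeval.1 hθ)

theorem lift_x {K J A : Type*} [Field K] [Field A] [Algebra K A] {θ : J → A}
    (hθ : AlgebraicIndependent K θ) (j : J) : lift hθ (x K j) = θ j := by
  rw [lift, x, IsFractionRing.liftAlgHom_apply]
  exact (IsFractionRing.lift_algebraMap (algebraicIndependent_iff_injective_aeval.1 hθ) _).trans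
    (MvPolynomial.aeval_X θ j)

theorem mem_range_lift_iff {K J A : Type*} [Field K] [Field A] [Algebra K A] {θ : J → A}
    (hθ : AlgebraicIndependent K θ) (a : A) :
    (∃ u, lift hθ u = a) ↔ a ∈ IntermediateField.adjoin K (Set.range θ) := by
  have : (IntermediateField.adjoin K (Set.range (x K))).map (lift hθ) =
      IntermediateField.adjoin K (Set.range θ) := by
    rw [IntermediateField.adjoin_map, ← Set.range_comp]
    congr 2
    exact funext (lift_x hθ)
  rw [← this, adjoin_range_x]
  simp

end RegularField

/-! ### Vandermonde inversion and rationality in an ambient field -/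

/-- The power sums of distinct nodes of a subfield determine the weights: if they lie in the
subfield, so do the weights. -/
theorem Subfield.mem_of_forall_sum_mul_pow_mem {E ι : Type*} [Field E] [Fintype ι]
    (W : Subfield E) {θ : ι → E} (hθ : Function.Injective θ) (hθW : ∀ i, θ i ∈ W) {v : ι → E}
    (hv : ∀ k < Fintype.card ι, ∑ i, v i * θ i ^ k ∈ W) (i : ι) : v i ∈ W := by
  classical
  let θ' : ι → W := fun i => ⟨θ i, hθW i⟩
  have hθ' : Set.InjOn θ' (Finset.univ : Finset ι) := fun a _ b _ h =>
    hθ (congrArg Subtype.val h)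
  -- P is 1 at θ i and 0 at the other nodes; its coefficients, which lie in W, express v i through
  -- the power sums.
  set P := Lagrange.basis Finset.univ θ' i with hP
  have hdeg : P.natDegree < Fintype.card ι := by
    have : P.natDegree = Fintype.card ι - 1 :=
      Polynomial.natDegree_eq_of_degree_eq_some (Lagrange.degree_basis hθ' (Finset.mem_univ i))
    have : 0 < Fintype.card ι := Fintype.card_pos_iff.2 ⟨i⟩
    omega
  have heval (j : ι) : ∑ k ∈ Finset.range (Fintype.card ι), (P.coeff k : E) * θ j ^ k =
      if j = i then 1 else 0 := by
    have h1 : P.eval (θ' j) = if j = i then 1 else 0 := by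
      split_ifs with h
      · rw [h]
        exact Lagrange.eval_basis_self hθ' (Finset.mem_univ i)
      · exact Lagrange.eval_basis_of_ne (Ne.symm h) (Finset.mem_univ j)
    rw [Polynomial.eval_eq_sum_range' hdeg] at h1
    simpa [apply_ite, θ'] using congrArg (W.subtype) h1
  have hsum : v i = ∑ k ∈ Finset.range (Fintype.card ι), (P.coeff k : E) * ∑ j, v j * θ j ^ k := by
    calc v i = ∑ j, v j * ∑ k ∈ Finset.range (Fintype.card ι), (P.coeff k : E) * θ j ^ k := by
          simp [heval]
      _ = _ := by
          simp_rw [Finset.mul_sum]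
          rw [Finset.sum_comm]
          exact Finset.sum_congr rfl fun k _ => Finset.sum_congr rfl fun j _ => by ring
  rw [hsum]
  exact sum_mem fun k hk => mul_mem (P.coeff k).2 (hv k (Finset.mem_range.1 hk))

/-- Rationality of an intermediate field can be checked in the ambient field. -/
theorem isRationalOver_of_mem_adjoin_iff {k K E : Type*} [Field k] [Field K] [Field E] [Algebra K E]
    (S : IntermediateField K E) [Algebra k S] [Algebra k E] [IsScalarTower k S E] {T : Set E}
    (hT : AlgebraicIndependent k ((↑) : T → E))
    (hTS : ∀ x, x ∈ IntermediateField.adjoin k T ↔ x ∈ S) : IsRationalOver k S := by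
  let f : S →ₐ[k] E := IsScalarTower.toAlgHom k S E
  have hf (s : S) : f s = s := rfl
  refine ⟨f ⁻¹' T, ?_, eq_top_iff.2 fun s _ => ?_⟩
  · refine AlgebraicIndependent.of_comp f
      (hT.comp (fun t : f ⁻¹' T => (⟨f t, t.2⟩ : T)) fun a b h => ?_)
    exact Subtype.ext (f.injective (congrArg (Subtype.val : T → E) h))
  · have himg : f '' (f ⁻¹' T) = T := Set.image_preimage_eq_of_subset fun t ht =>
      ⟨⟨t, (hTS t).1 (IntermediateField.subset_adjoin k T ht)⟩, rfl⟩
    have hs := (hTS s).2 s.2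
    rw [← himg, ← IntermediateField.adjoin_map] at hs
    obtain ⟨t, ht, hts⟩ := hs
    exact f.injective hts ▸ ht

/-! ### The regular representation -/

/-- The regular representation of `H` on the finitely supported functions `H →₀ K`. -/
noncomputable def finsuppRegular (K H : Type*) [Field K] [Group H] :
    Representation K H (H →₀ K) where
  toFun h := Finsupp.lmapDomain K K (h * ·)
  map_one' := by ext; simp
  map_mul' a b := by ext; simp [mul_assoc]

theorem finsuppRegular_single {K H : Type*} [Field K] [Group H] (h g : H) (a : K) :
    finsuppRegular K H h (Finsupp.single g a) = Finsupp.single (h * g) a :=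
  Finsupp.mapDomain_single

/-- The regular representation of a finite `p`-group in characteristic `p` has a unitriangular
spanning family. -/
theorem IsPGroup.exists_unitriangular_regular {p : ℕ} [Fact p.Prime] {K : Type*} [Field K]
    [CharP K p] {H : Type*} [Group H] [Finite H] (hH : IsPGroup p H) :
    ∃ b : Fin (Nat.card H) → H →₀ K, (∀ i, b i ≠ 0) ∧ Submodule.span K (Set.range b) = ⊤ ∧
      ∀ h i, finsuppRegular K H h (b i) - b i ∈
        Submodule.span K (b '' Set.Iio i) := by
  have := Fintype.ofFinite H
  have hcard : Module.finrank K (H →₀ K) = Nat.card H := by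
    rw [Module.finrank_finsupp_self, Nat.card_eq_fintype_card]
  obtain ⟨b, hb, htri⟩ := hH.exists_unitriangular (finsuppRegular K H)
    (Nat.card H) hcard.ge
  exact ⟨b, hb.ne_zero, hb.span_eq_top_of_card_eq_finrank' (by simp [hcard]), htri⟩

/-! ### Kuniyoshi's theorem -/

/-- Kuniyoshi's theorem. -/
theorem isRationalOver_noetherField_of_isPGroup {p : ℕ} [Fact p.Prime] (K : Type*) [Field K]
    [CharP K p] {H : Type*} [Group H] [Finite H] (hH : IsPGroup p H) :
    IsRationalOver K (noetherField K H) := by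
  obtain ⟨b, -, hspan, htri⟩ := hH.exists_unitriangular_regular (K := K)
  let Y : (H →₀ K) →ₗ[K] RegularField K H := Finsupp.linearCombination K (RegularField.x K)
  have hY (γ : H) (c : H →₀ K) :
      regularAction K H γ (Y c) = Y (finsuppRegular K H γ c) := by
    have : (regularAction K H γ).toLinearMap ∘ₗ Y = Y ∘ₗ finsuppRegular K H γ := by
      ext h
      simp [Y, regularAction_x, finsuppRegular_single]
    exact LinearMap.congr_fun this c
  have hYmem (W : IntermediateField K (RegularField K H)) {t : Set (H →₀ K)}
      (ht : ∀ c ∈ t, Y c ∈ W) {c : H →₀ K} (hc : c ∈ Submodule.span K t) : Y c ∈ W :=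
    (Submodule.span_le (p := W.toSubalgebra.toSubmodule.comap Y)).2 ht hc
  have htop : IntermediateField.adjoin K (Set.range (Y ∘ b)) = ⊤ := by
    rw [eq_top_iff, ← RegularField.adjoin_range_x, IntermediateField.adjoin_le_iff]
    rintro _ ⟨h, rfl⟩
    have : Y (Finsupp.single h 1) = RegularField.x K h := by simp [Y]
    rw [← this]
    refine hYmem _ (t := Set.range b) ?_ (hspan ▸ Submodule.mem_top)
    rintro _ ⟨i, rfl⟩
    exact IntermediateField.subset_adjoin K _ ⟨i, rfl⟩
  obtain ⟨T, hT, hTfix⟩ := exists_algebraicIndependent_fixed_of_triangular (k := K)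
    (regularAction K H) (RegularField.algebraicIndependent_of_adjoin_eq_top
      (Finite.equivFin H).symm htop) (fun i => i) ∅ (by simp)
    (fun γ i _ => by
      rw [Function.comp_apply, hY, ← map_sub]
      refine hYmem _ (t := b '' Set.Iio i) ?_ (htri γ i)
      rintro _ ⟨j, hj, rfl⟩
      exact IntermediateField.subset_adjoin K _ ⟨j, Or.inr hj, rfl⟩)
    (fun x => by
      rw [Set.image_empty, IntermediateField.adjoin_empty, IntermediateField.mem_bot]
      refine ⟨fun h => ⟨h, ?_⟩, And.left⟩
      obtain ⟨a, rfl⟩ := h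
      exact fun γ => AlgEquiv.commutes _ a)
  refine isRationalOver_of_mem_adjoin_iff _ hT fun x => ?_
  rw [hTfix, htop, mem_noetherField_iff]
  exact and_iff_right IntermediateField.mem_top

/-! ### Direct products -/

/-- For a finite `p`-group `H` in characteristic `p`, the field `K(H × G)` is rational over an
embedded copy of `K(G)`. -/
theorem exists_isRationalOver_noetherField_prod {p : ℕ} [Fact p.Prime] (K : Type*) [Field K]
    [CharP K p] {H G : Type*} [Group H] [Finite H] [Group G] [Finite G] (hH : IsPGroup p H) :
    ∃ φ : noetherField K G →ₐ[K] noetherField K (H × G),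
      IsRationalOver φ.fieldRange (noetherField K (H × G)) := by
  have := Fintype.ofFinite G
  obtain ⟨b, hb0, hspan, htri⟩ := hH.exists_unitriangular_regular (K := K)
  have : NeZero (Nat.card H) := ⟨Nat.card_pos.ne'⟩
  let E := RegularField K (H × G)
  let Y (g : G) : (H →₀ K) →ₗ[K] E := Finsupp.linearCombination K fun h => RegularField.x K (h, g)
  have hY (γ : H × G) (g : G) (c : H →₀ K) : regularAction K (H × G) γ (Y g c) =
      Y (γ.2 * g) (finsuppRegular K H γ.1 c) := by
    have : (regularAction K (H × G) γ).toLinearMap ∘ₗ Y g =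
        Y (γ.2 * g) ∘ₗ finsuppRegular K H γ.1 := by
      ext h
      simp [Y, regularAction_x, finsuppRegular_single]
      rfl
    exact LinearMap.congr_fun this c
  let θ (g : G) : E := Y g (b 0)
  have hθ_inj : Function.Injective θ := fun g g' h => by
    have hY' (g : G) : θ g = Finsupp.linearCombination K (RegularField.x K)
        ((b 0).mapDomain fun h : H => (h, g)) := by
      rw [Finsupp.linearCombination_mapDomain]
      rfl
    rw [hY', hY'] at h
    replace h := (RegularField.algebraicIndependent_x K (H × G)).linearIndependent h
    by_contra hne
    obtain ⟨a, ha⟩ := Finsupp.ne_iff.1 (hb0 0)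
    have h1 := DFunLike.congr_fun h (a, g)
    rw [Finsupp.mapDomain_apply (fun _ _ h => congrArg Prod.fst h) (b 0) a,
      Finsupp.mapDomain_of_notMem_range _ _ (by rintro ⟨_, h⟩; exact hne (congrArg Prod.snd h).symm)]
      at h1
    exact ha h1
  have hθ (γ : H × G) (g : G) : regularAction K (H × G) γ (θ g) = θ (γ.2 * g) := by
    -- No index lies below 0, so unitriangularity makes b 0 fixed by H.
    have h0 : finsuppRegular K H γ.1 (b 0) - b 0 = 0 := by
      have h1 := htri γ.1 0
      have : Set.Iio (0 : Fin (Nat.card H)) = ∅ := by ext; simp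
      rwa [this, Set.image_empty, Submodule.span_empty, Submodule.mem_bot] at h1
    change regularAction K (H × G) γ (Y g (b 0)) = _
    rw [hY, sub_eq_zero.1 h0]
  let Z (k : ℕ) : (H →₀ K) →ₗ[K] E := ∑ g, LinearMap.mulRight K (θ g ^ k) ∘ₗ Y g
  have hZ_apply (k : ℕ) (c : H →₀ K) : Z k c = ∑ g, Y g c * θ g ^ k := by
    simp [Z]
  have hZ (γ : H × G) (k : ℕ) (c : H →₀ K) :
      regularAction K (H × G) γ (Z k c) = Z k (finsuppRegular K H γ.1 c) := by
    rw [hZ_apply, hZ_apply, map_sum]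
    refine Fintype.sum_equiv (Equiv.mulLeft γ.2) _ _ fun g => ?_
    rw [map_mul, map_pow, hY, hθ]
    rfl
  have hmem (W : IntermediateField K E) (f : (H →₀ K) →ₗ[K] E) {t : Set (H →₀ K)}
      (ht : ∀ c ∈ t, f c ∈ W) {c : H →₀ K} (hc : c ∈ Submodule.span K t) : f c ∈ W :=
    (Submodule.span_le (p := W.toSubalgebra.toSubmodule.comap f)).2 ht hc
  let e := Fintype.equivFin G
  -- Row 0 keeps the θ(g); in the other rows `e` turns g into the exponent of a moment, giving
  -- |H|·|G| generators in all.
  let w (i : Fin (Nat.card H) × G) : E := if i.1 = 0 then θ i.2 else Z (e i.2) (b i.1)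
  have hw0 (g : G) : w (0, g) = θ g := if_pos rfl
  have hw1 {i : Fin (Nat.card H)} (hi : i ≠ 0) (g : G) : w (i, g) = Z (e g) (b i) := if_neg hi
  have htop : IntermediateField.adjoin K (Set.range w) = ⊤ := by
    set W := IntermediateField.adjoin K (Set.range w)
    have hwW (i) : w i ∈ W := IntermediateField.subset_adjoin K _ ⟨i, rfl⟩
    rw [eq_top_iff, ← RegularField.adjoin_range_x, IntermediateField.adjoin_le_iff]
    rintro _ ⟨⟨h, g⟩, rfl⟩
    have : Y g (Finsupp.single h 1) = RegularField.x K (h, g) := by simp [Y]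
    rw [← this]
    refine hmem _ (Y g) (t := Set.range b) ?_ (hspan ▸ Submodule.mem_top)
    rintro _ ⟨i, rfl⟩
    by_cases hi : i = 0
    · rw [hi]
      exact (hw0 g).subst (motive := fun y => y ∈ W) (hwW (0, g))
    · refine W.toSubfield.mem_of_forall_sum_mul_pow_mem hθ_inj (fun g => hw0 g ▸ hwW (0, g))
        (v := fun g => Y g (b i)) (fun k hk => ?_) g
      have := hwW (i, e.symm ⟨k, hk⟩)
      rw [hw1 hi, Equiv.apply_symm_apply, hZ_apply] at this
      exact this
  have hw : AlgebraicIndependent K w := RegularField.algebraicIndependent_of_adjoin_eq_top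
    ((Finite.equivFin H).symm.prodCongr (Equiv.refl G)) htop
  have hθ_ind : AlgebraicIndependent K θ := by
    have := hw.comp (fun g => ((0 : Fin (Nat.card H)), g)) (Prod.mk_right_injective 0)
    rwa [show w ∘ (fun g => (0, g)) = θ from funext hw0] at this
  let φ₀ := RegularField.lift hθ_ind
  have hφ₀ (γ : H × G) (u : RegularField K G) :
      regularAction K (H × G) γ (φ₀ u) = φ₀ (regularAction K G γ.2 u) := by
    have : (regularAction K (H × G) γ : E →ₐ[K] E).comp φ₀ =
        φ₀.comp (regularAction K G γ.2 : RegularField K G →ₐ[K] RegularField K G) :=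
      RegularField.algHom_ext fun g => by
        simp [φ₀, RegularField.lift_x, hθ, regularAction_x]
    exact congrArg (fun ψ : RegularField K G →ₐ[K] E => ψ u) this
  let φ : noetherField K G →ₐ[K] noetherField K (H × G) :=
    (φ₀.comp (noetherField K G).val).codRestrict (noetherField K (H × G)).toSubalgebra fun u =>
      (mem_noetherField_iff _).2 fun γ => by
        change regularAction K (H × G) γ (φ₀ u) = φ₀ u
        rw [hφ₀, (mem_noetherField_iff _).1 u.2]
  let s₀ : Set (Fin (Nat.card H) × G) := {i | i.1 = 0}
  have hws₀ : w '' s₀ = Set.range θ := by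
    ext u
    constructor
    · rintro ⟨⟨i, g⟩, rfl, rfl⟩
      exact ⟨g, (hw0 g).symm⟩
    · rintro ⟨g, rfl⟩
      exact ⟨(0, g), rfl, hw0 g⟩
  refine ⟨φ, ?_⟩
  have hstab (γ : H × G) (i) (hi : i ∈ s₀) :
      regularAction K (H × G) γ (w i) ∈ IntermediateField.adjoin K (w '' s₀) := by
    obtain ⟨i, g⟩ := i
    obtain rfl : i = 0 := hi
    rw [hw0, hθ, hws₀]
    exact IntermediateField.subset_adjoin K _ ⟨_, rfl⟩
  have htrans (γ : H × G) (i) (hi : i ∉ s₀) : regularAction K (H × G) γ (w i) - w i ∈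
      IntermediateField.adjoin K (w '' (s₀ ∪ {j | (j.1 : ℕ) < i.1})) := by
    obtain ⟨i, g⟩ := i
    rw [hw1 hi, hZ, ← map_sub]
    refine hmem _ (Z (e g)) (t := b '' Set.Iio i) ?_ (htri γ.1 i)
    rintro _ ⟨j, hj, rfl⟩
    by_cases hj0 : j = 0
    -- Z_k(b_0) is not a member of w, but it equals Σ_g θ(g)^(k+1) and so lies in K(θ).
    · subst hj0
      rw [hZ_apply]
      have hθmem (g : G) : θ g ∈ IntermediateField.adjoin K
          (w '' (s₀ ∪ {j | (j.1 : ℕ) < i})) :=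
        IntermediateField.subset_adjoin K _ ⟨(0, g), Or.inl rfl, hw0 g⟩
      exact sum_mem fun g' _ => mul_mem (hθmem g') (pow_mem (hθmem g') _)
    · exact IntermediateField.subset_adjoin K _ ⟨(j, g), Or.inr hj, hw1 hj0 g⟩
  have hrange (x : E) : x ∈ Set.range (algebraMap φ.fieldRange E) ↔
      x ∈ IntermediateField.adjoin K (w '' s₀) ∧ ∀ γ, regularAction K (H × G) γ x = x := by
    rw [hws₀, ← RegularField.mem_range_lift_iff hθ_ind]
    constructor
    · rintro ⟨⟨_, u, rfl⟩, rfl⟩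
      exact ⟨⟨u, rfl⟩, (mem_noetherField_iff _).1 (φ u).2⟩
    · rintro ⟨⟨u, rfl⟩, hfix⟩
      -- Invariance under the elements (1, g) suffices, since φ₀ is injective and H acts trivially
      -- on its image.
      have hu : u ∈ noetherField K G := (mem_noetherField_iff u).2 fun g =>
        φ₀.injective ((hφ₀ (1, g) u).symm.trans (hfix (1, g)))
      exact ⟨⟨φ ⟨u, hu⟩, ⟨u, hu⟩, rfl⟩, rfl⟩
  obtain ⟨T, hT, hTfix⟩ := exists_algebraicIndependent_fixed_of_triangular
    (regularAction K (H × G)) hw (fun i => i.1) s₀ hstab htrans hrange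
  refine isRationalOver_of_mem_adjoin_iff _ hT fun x => ?_
  rw [hTfix, htop, mem_noetherField_iff]
  exact and_iff_right IntermediateField.mem_top

theorem theorem1p7 {K : Type*} [Field K] (p : ℕ) [CharP K p] (hp : 0 < p)
    {H G : Type*} [Group H] [Finite H] [Group G] [Finite G] (hH : IsPGroup p H) :
    (∃ φ : noetherField K G →ₐ[K] noetherField K (H × G),
      IsRationalOver φ.fieldRange (noetherField K (H × G))) ∧
    IsRationalOver K (noetherField K H) := by
  have : Fact p.Prime := ⟨(CharP.char_is_prime_or_zero K p).resolve_right hp.ne'⟩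
  exact ⟨exists_isRationalOver_noetherField_prod K hH, isRationalOver_noetherField_of_isPGroup K hH⟩
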